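/- Let $0\le d\le p$ be integers. Say that a random vector $\mathbf{x}\in\mathbb{R}^p$ follows the signal separation model with parameters $(\boldsymbol\mu,\boldsymbol\Omega)$, where $\boldsymbol\mu\in\mathbb{R}^p$ and $\boldsymbol\Omega=(\boldsymbol\Omega_1,\boldsymbol\Omega_2)\in\mathbb{R}^{p\times p}$ is non-singular with $\boldsymbol\Omega_1\in\mathbb{R}^{p\times d}$ and $\boldsymbol\Omega_2\in\mathbb{R}^{p\times(p-d)}$, if almost surely $$\mathbf{x}=\boldsymbol\mu+\boldsymbol\Omega\mathbf{z}=\boldsymbol\mu+\boldsymbol\Omega_1\mathbf{s}+\boldsymbol\Omega_2\mathbf{n},\qquad \mathbf{z}=\begin{pmatrix}\mathbf{s}\\ \mathbf{n}\end{pmatrix},\quad \mathbf{s}\in\mathbb{R}^d,\ \mathbf{n}\in\mathbb{R}^{p-d},$$ where the components $z_1,\dots,z_p$ of the random vector $\mathbf{z}$ are mutually independent and standardized ($E(z_k)=0$ and $E(z_k^2)=1$ for all $k$), every component of $\mathbf{s}$ is non-Gaussian and every component of $\mathbf{n}$ is Gaussian. Then $\boldsymbol\Omega_1$ is identified by the distribution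 of $\mathbf{x}$ up to the signs and the permutation of its columns: if $\mathbf{x}$ follows the model with parameters $(\boldsymbol\mu,\boldsymbol\Omega)$, $\mathbf{x}^*$ follows the model with parameters $(\boldsymbol\mu^*,\boldsymbol\Omega^*)$ (with the same $p$ and $d$, the two vectors being possibly defined on different probability spaces), and $\mathbf{x}$ and $\mathbf{x}^*$ have the same distribution, then there are a permutation $\sigma$ of $\{1,\dots,d\}$ and signs $\varepsilon_1,\dots,\varepsilon_d\in\{-1,1\}$ such that, for every $j=1,\dots,d$, the $j$-th column of $\boldsymbol\Omega_1^*$ is $\varepsilon_j$ times the $\sigma(j)$-th column of $\boldsymbol\Omega_1$. -/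

import Mathlib

open MeasureTheory ProbabilityTheory

/-- The random vector `x` follows the signal separation model `x = μ + Ω z` on the probability
space `(S, P)`, with `Ω` non-singular and `z = (s, n)`, where `s` consists of the first `d`
components of `z` and `n` of the remaining `p - d` ones:
the components of `z` are mutually independent and standardized (mean zero, unit variance), those
of `s` are non-Gaussian and those of `n` are Gaussian. -/
structure IsSignalSeparationModel {S : Type*} [MeasurableSpace S] (P : Measure S) {p : ℕ} (d : ℕ)
    (μ : Fin p → ℝ) (Ω : Matrix (Fin p) (Fin p) ℝ) (z x : S → Fin p → ℝ) : Prop where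
  nonsingular : IsUnit Ω.det
  indep : iIndepFun (fun (k : Fin p) (ω : S) => z ω k) P
  memLp : ∀ k : Fin p, MemLp (fun ω => z ω k) 2 P
  mean_eq_zero : ∀ k : Fin p, ∫ ω, z ω k ∂P = 0
  second_moment_eq_one : ∀ k : Fin p, ∫ ω, z ω k ^ 2 ∂P = 1
  signal_nonGaussian : ∀ k : Fin p, k.val < d → ¬ HasGaussianLaw (fun ω => z ω k) P
  noise_gaussian : ∀ k : Fin p, d ≤ k.val → HasGaussianLaw (fun ω => z ω k) P
  observed_eq : ∀ᵐ ω ∂P, x ω = μ + Ω.mulVec (z ω)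

/-- The block `Ω₁` in `Ω = (Ω₁, Ω₂)`, made of the first `d` columns of `Ω`. -/
def signalBlock {p d : ℕ} (hd : d ≤ p) (Ω : Matrix (Fin p) (Fin p) ℝ) :
    Matrix (Fin p) (Fin d) ℝ :=
  Ω.submatrix id (Fin.castLE hd)

/-! Put `A = Ω'⁻¹ Ω`. Since both source vectors are centred, `y = A z` has the law of `z'`; since
both have identity covariance, `A` is orthogonal. If a column `k` of `A` had two nonzero entries, `z
k` would enter two independent coordinates of `y` and would be Gaussian by Darmois-Skitovich. So a
signal column has a single entry `±1`, alone in its row by orthogonality. The matching coordinate of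
`y` is `± z k`, hence non-Gaussian and itself a signal. This gives the permutation, and `Ω = Ω' A`
transfers it to the columns.

Invertibility of `A` makes Darmois-Skitovich elementary. Write `W = z k`, with `X`, `Y` the two
coordinates it enters. As `W = a X + b Y + R`, the variable `e = exp (i t W)` splits into
independent factors and `E[e] E[X Y e] = E[X e] E[Y e]`. Expanding `X = α W + U`, `Y = β W + V`
turns this into `φ φ'' - φ' ^ 2 = - φ ^ 2`, that is `(log φ)'' = -1`, for the characteristic
function `φ` of `W`. -/

/-! ### Gaussian laws from a differential equation -/

/-- The differential equation `f f'' - f' ^ 2 = - f ^ 2` with `f 0 = 1`, `f' 0 = 0` characterizes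
the function `exp (-t ^ 2 / 2)`. -/
lemma eq_exp_neg_sq_div_two_of_hasDerivAt {f f' f'' : ℝ → ℂ}
    (hf : ∀ t, HasDerivAt f (f' t) t) (hf' : ∀ t, HasDerivAt f' (f'' t) t)
    (h : ∀ t, f t * f'' t - f' t ^ 2 = - f t ^ 2) (h0 : f 0 = 1) (h0' : f' 0 = 0) (t : ℝ) :
    f t = Complex.exp (-(t : ℂ) ^ 2 / 2) := by
  have hfc : Continuous f := continuous_iff_continuousAt.2 fun t => (hf t).continuousAt
  have hfc' : Continuous f' := continuous_iff_continuousAt.2 fun t => (hf' t).continuousAt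
  have hid : ∀ s : ℝ, HasDerivAt (fun s : ℝ => (s : ℂ)) 1 s := fun s => Complex.ofRealCLM.hasDerivAt
  have hE : ∀ s : ℝ, HasDerivAt (fun s : ℝ => Complex.exp ((s : ℂ) ^ 2 / 2))
      (s * Complex.exp ((s : ℂ) ^ 2 / 2)) s := by
    intro s
    refine (((hid s).pow 2).div_const 2).cexp.congr_deriv ?_
    simp only [Pi.pow_apply]
    ring
  -- `log f` is unavailable where `f` vanishes, so the solution is propagated by a clopen argument.
  -- On `S` the function `f` is nonzero, and the condition on `f'` supplies the initial value for
  -- the next ball.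
  let S : Set ℝ := {s | f s * Complex.exp ((s : ℂ) ^ 2 / 2) = 1 ∧ f' s = -s * f s}
  have hclosed : IsClosed S :=
    (isClosed_eq (by fun_prop) (by fun_prop)).inter (isClosed_eq (by fun_prop) (by fun_prop))
  have hopen : IsOpen S := by
    rw [Metric.isOpen_iff]
    rintro a ⟨ha, ha'⟩
    have hfa : f a ≠ 0 := fun h => by simp [h] at ha
    obtain ⟨δ, hδ, hball⟩ := Metric.isOpen_iff.1 (isOpen_ne_fun hfc continuous_const) a hfa
    refine ⟨δ, hδ, ?_⟩
    have hpre : IsPreconnected (Metric.ball a δ) := (convex_ball a δ).isPreconnected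
    have hmem : a ∈ Metric.ball a δ := Metric.mem_ball_self hδ
    -- This is `(log f)'' + 1 = 0`.
    have hr : ∀ s ∈ Metric.ball a δ, HasDerivAt (fun s : ℝ => f' s / f s + s) 0 s := by
      intro s hs
      have hfs : f s ≠ 0 := hball hs
      refine (((hf' s).div (hf s) hfs).add (hid s)).congr_deriv ?_
      field_simp
      linear_combination h s
    have hr0 : ∀ s ∈ Metric.ball a δ, f' s = -s * f s := by
      intro s hs
      have hfs : f s ≠ 0 := hball hs
      have := Metric.isOpen_ball.is_const_of_deriv_eq_zero hpre
        (fun s hs => (hr s hs).differentiableAt.differentiableWithinAt)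
        (fun s hs => (hr s hs).deriv) hs hmem
      simp only [ha', mul_div_assoc, div_self hfa] at this
      field_simp at this
      linear_combination this
    have hg : ∀ s ∈ Metric.ball a δ,
        HasDerivAt (fun s : ℝ => f s * Complex.exp ((s : ℂ) ^ 2 / 2)) 0 s := by
      intro s hs
      refine ((hf s).mul (hE s)).congr_deriv ?_
      rw [hr0 s hs]; ring
    intro s hs
    refine ⟨?_, hr0 s hs⟩
    rw [← ha]
    exact Metric.isOpen_ball.is_const_of_deriv_eq_zero hpre
      (fun s hs => (hg s hs).differentiableAt.differentiableWithinAt)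
      (fun s hs => (hg s hs).deriv) hs hmem
  have huniv : S = Set.univ := IsClopen.eq_univ ⟨hclosed, hopen⟩ ⟨0, by simp [S, h0, h0']⟩
  have ht : f t * Complex.exp ((t : ℂ) ^ 2 / 2) = 1 := (huniv ▸ Set.mem_univ t : t ∈ S).1
  rw [neg_div, Complex.exp_neg]
  exact eq_inv_of_mul_eq_one_left ht

/-- A standardized random variable whose characteristic function `φ` satisfies
`φ φ'' - φ' ^ 2 = - φ ^ 2` is Gaussian. -/
lemma hasGaussianLaw_of_charFun_ode {S : Type*} [MeasurableSpace S] {P : Measure S}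
    [IsProbabilityMeasure P] {W : S → ℝ} (hW : MemLp W 2 P) (hmean : ∫ ω, W ω ∂P = 0)
    (h : ∀ t : ℝ, (∫ ω, Complex.exp (t * W ω * Complex.I) ∂P) *
        (∫ ω, (W ω : ℂ) ^ 2 * Complex.exp (t * W ω * Complex.I) ∂P -
          ∫ ω, Complex.exp (t * W ω * Complex.I) ∂P) =
        (∫ ω, (W ω : ℂ) * Complex.exp (t * W ω * Complex.I) ∂P) ^ 2) :
    HasGaussianLaw W P := by
  have hWm := hW.aestronglyMeasurable.aemeasurable
  have : IsProbabilityMeasure (P.map W) := Measure.isProbabilityMeasure_map hWm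
  have hid : MemLp id 2 (P.map W) := (memLp_map_measure_iff (by fun_prop) hWm).2 hW
  have hid1 : MemLp id 1 (P.map W) := hid.mono_exponent (by norm_num)
  have e0 : ∀ t : ℝ, charFun (P.map W) t = ∫ ω, Complex.exp (t * W ω * Complex.I) ∂P := by
    intro t
    rw [charFun_apply_real, integral_map hWm (by fun_prop)]
  have e1 : ∀ t : ℝ, deriv (charFun (P.map W)) t =
      Complex.I * ∫ ω, (W ω : ℂ) * Complex.exp (t * W ω * Complex.I) ∂P := by
    intro t
    rw [← iteratedDeriv_one, iteratedDeriv_charFun (by exact_mod_cast hid1),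
      integral_map hWm (by fun_prop)]
    simp
  have e2 : ∀ t : ℝ, deriv (deriv (charFun (P.map W))) t =
      - ∫ ω, (W ω : ℂ) ^ 2 * Complex.exp (t * W ω * Complex.I) ∂P := by
    intro t
    have := iteratedDeriv_charFun (n := 2) (t := t) (by exact_mod_cast hid)
    rw [integral_map hWm (by fun_prop), iteratedDeriv_succ, iteratedDeriv_one] at this
    simpa using this
  have hC : ContDiff ℝ 2 (charFun (P.map W)) := contDiff_charFun (n := 2) (by exact_mod_cast hid)
  have hd : ∀ t, HasDerivAt (charFun (P.map W)) (deriv (charFun (P.map W)) t) t := fun t =>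
    (hC.differentiable (by norm_num) t).hasDerivAt
  have hd' : ∀ t, HasDerivAt (deriv (charFun (P.map W))) (deriv (deriv (charFun (P.map W))) t) t :=
    fun t => (hC.differentiable_deriv_two t).hasDerivAt
  have key := eq_exp_neg_sq_div_two_of_hasDerivAt hd hd' (fun t => by
    rw [e0, e1, e2, mul_pow, Complex.I_sq]
    linear_combination -h t) (by simp) (by
    rw [e1]
    simp [integral_complex_ofReal, hmean])
  refine ⟨?_⟩
  have : P.map W = gaussianReal 0 1 := by
    refine Measure.ext_of_charFun (funext fun t => ?_)
    rw [key, charFun_gaussianReal]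
    simp [neg_div]
  rw [this]
  infer_instance

/-! ### Darmois-Skitovich with second moments -/

/-- A form of the Darmois-Skitovich theorem for square integrable variables: let `W` be
standardized and independent of the centered pair `(U, V)`, and put `X = α W + U`,
`Y = β W + V`. If `W` is in turn a combination `a X + b Y + R` with `X`, `Y`, `R` independent,
and if `α β ≠ 0`, then `W` is Gaussian. -/
lemma hasGaussianLaw_of_indepFun_combinations {S : Type*} [MeasurableSpace S] {P : Measure S}
    [IsProbabilityMeasure P] {W U V X Y R : S → ℝ} {α β a b : ℝ}
    (hW : MemLp W 2 P) (hU : MemLp U 2 P) (hV : MemLp V 2 P) (hR : AEMeasurable R P)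
    (hWmean : ∫ ω, W ω ∂P = 0) (hUmean : ∫ ω, U ω ∂P = 0) (hVmean : ∫ ω, V ω ∂P = 0)
    (hWvar : ∫ ω, W ω ^ 2 ∂P = 1)
    (hWUV : IndepFun W (fun ω => (U ω, V ω)) P)
    (hX : ∀ ω, X ω = α * W ω + U ω) (hY : ∀ ω, Y ω = β * W ω + V ω)
    (hXYR : IndepFun X (fun ω => (Y ω, R ω)) P) (hYR : IndepFun Y R P)
    (hdec : ∀ ω, W ω = a * X ω + b * Y ω + R ω) (hαβ : α * β ≠ 0) :
    HasGaussianLaw W P := by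
  have hWm := hW.aestronglyMeasurable.aemeasurable
  have hUm := hU.aestronglyMeasurable.aemeasurable
  have hVm := hV.aestronglyMeasurable.aemeasurable
  have hX2 : MemLp X 2 P := by
    rw [funext hX]; exact (hW.const_mul α).add hU
  have hY2 : MemLp Y 2 P := by
    rw [funext hY]; exact (hW.const_mul β).add hV
  have hXm := hX2.aestronglyMeasurable.aemeasurable
  have hYm := hY2.aestronglyMeasurable.aemeasurable
  have hWi := hW.integrable (by norm_num)
  have hUi := hU.integrable (by norm_num)
  have hVi := hV.integrable (by norm_num)
  refine hasGaussianLaw_of_charFun_ode hW hWmean fun t => ?_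
  set e : S → ℂ := fun ω => Complex.exp (t * W ω * Complex.I) with he
  have hem : AEStronglyMeasurable e P := by
    refine AEMeasurable.aestronglyMeasurable ?_
    fun_prop
  have henorm : ∀ ω, ‖e ω‖ ≤ 1 := fun ω => by
    simp only [he]
    rw [← Complex.ofReal_mul, Complex.norm_exp_ofReal_mul_I]
  have hint : ∀ g : S → ℝ, Integrable g P → Integrable (fun ω => (g ω : ℂ) * e ω) P := fun g hg =>
    hg.ofReal.mul_bdd hem (Filter.Eventually.of_forall henorm)
  have hUV : ∀ (n : ℕ) (g : ℝ × ℝ → ℝ), Measurable g →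
      ∫ ω, ((W ω : ℂ) ^ n * e ω) * (g (U ω, V ω) : ℂ) ∂P =
        (∫ ω, (W ω : ℂ) ^ n * e ω ∂P) * ((∫ ω, g (U ω, V ω) ∂P : ℝ) : ℂ) := by
    intro n g hg
    rw [← integral_complex_ofReal]
    exact hWUV.integral_fun_comp_mul_comp
      (f := fun w : ℝ => (w : ℂ) ^ n * Complex.exp (t * w * Complex.I))
      (g := fun p : ℝ × ℝ => (g p : ℂ)) hWm (hUm.prodMk hVm)
      (by fun_prop) (by fun_prop)
  have hfactor : ∀ m n : ℕ, ∫ ω, (X ω : ℂ) ^ m * (Y ω : ℂ) ^ n * e ω ∂P =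
      (∫ ω, (X ω : ℂ) ^ m * Complex.exp (t * a * X ω * Complex.I) ∂P) *
      ((∫ ω, (Y ω : ℂ) ^ n * Complex.exp (t * b * Y ω * Complex.I) ∂P) *
        ∫ ω, Complex.exp (t * R ω * Complex.I) ∂P) := by
    intro m n
    have h1 := hYR.integral_fun_comp_mul_comp
      (f := fun y : ℝ => (y : ℂ) ^ n * Complex.exp (t * b * y * Complex.I))
      (g := fun r : ℝ => Complex.exp (t * r * Complex.I)) hYm hR (by fun_prop) (by fun_prop)
    have h2 := hXYR.integral_fun_comp_mul_comp
      (f := fun x : ℝ => (x : ℂ) ^ m * Complex.exp (t * a * x * Complex.I))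
      (g := fun p : ℝ × ℝ => (p.1 : ℂ) ^ n * Complex.exp (t * b * p.1 * Complex.I) *
        Complex.exp (t * p.2 * Complex.I)) hXm (hYm.prodMk hR) (by fun_prop) (by fun_prop)
    rw [← h1, ← h2]
    refine integral_congr_ae (Filter.Eventually.of_forall fun ω => ?_)
    have : e ω = Complex.exp (t * a * X ω * Complex.I) *
        (Complex.exp (t * b * Y ω * Complex.I) * Complex.exp (t * R ω * Complex.I)) := by
      rw [← Complex.exp_add, ← Complex.exp_add]
      simp only [he, hdec ω]
      congr 1
      push_cast
      ring
    simp only [this]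
    ring
  -- `X` and `Y` are independent and centred, so the covariance of `U` and `V` must cancel the
  -- contribution `α β` of `W`.
  have hUVcov : ∫ ω, U ω * V ω ∂P = - (α * β) := by
    have hXmean : ∫ ω, X ω ∂P = 0 := by
      simp_rw [hX]
      rw [integral_add (hWi.const_mul α) hUi, integral_const_mul, hWmean, hUmean]
      simp
    have hXY : ∫ ω, X ω * Y ω ∂P = 0 := by
      have : IndepFun X Y P := hXYR.comp measurable_id measurable_fst
      rw [this.integral_fun_mul_eq_mul_integral hX2.1 hY2.1, hXmean, zero_mul]
    have hWV : ∫ ω, W ω * V ω ∂P = 0 := by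
      have : IndepFun W V P := hWUV.comp measurable_id measurable_snd
      rw [this.integral_fun_mul_eq_mul_integral hW.1 hV.1, hWmean, zero_mul]
    have hWU : ∫ ω, W ω * U ω ∂P = 0 := by
      have : IndepFun W U P := hWUV.comp measurable_id measurable_fst
      rw [this.integral_fun_mul_eq_mul_integral hW.1 hU.1, hWmean, zero_mul]
    have hexp : ∀ ω, U ω * V ω = X ω * Y ω - α * β * W ω ^ 2 - α * (W ω * V ω)
        - β * (W ω * U ω) := fun ω => by rw [hX, hY]; ring
    simp_rw [hexp]
    have i1 : Integrable (fun ω => X ω * Y ω) P := hX2.integrable_mul hY2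
    have i2 : Integrable (fun ω => α * β * W ω ^ 2) P := hW.integrable_sq.const_mul _
    have i3 : Integrable (fun ω => α * (W ω * V ω)) P := (hW.integrable_mul hV).const_mul _
    have i4 : Integrable (fun ω => β * (W ω * U ω)) P := (hW.integrable_mul hU).const_mul _
    rw [integral_sub (by exact (i1.sub i2).sub i3) i4, integral_sub (by exact i1.sub i2) i3, integral_sub i1 i2,
      integral_const_mul, integral_const_mul, integral_const_mul, hXY, hWV, hWU, hWvar]
    ring
  have hXe : ∫ ω, (X ω : ℂ) * e ω ∂P = α * ∫ ω, (W ω : ℂ) * e ω ∂P := by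
    have hexp : ∀ ω, (X ω : ℂ) * e ω = α * ((W ω : ℂ) * e ω) + (U ω : ℂ) * e ω := fun ω => by
      rw [hX]; push_cast; ring
    have h0 := hUV 0 Prod.fst measurable_fst
    simp only [pow_zero, one_mul, hUmean, Complex.ofReal_zero, mul_zero] at h0
    simp_rw [hexp]
    rw [integral_add ((hint W hWi).const_mul _) (hint U hUi), integral_const_mul,
      integral_congr_ae (Filter.Eventually.of_forall fun ω => mul_comm (U ω : ℂ) (e ω)), h0,
      add_zero]
  have hYe : ∫ ω, (Y ω : ℂ) * e ω ∂P = β * ∫ ω, (W ω : ℂ) * e ω ∂P := by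
    have hexp : ∀ ω, (Y ω : ℂ) * e ω = β * ((W ω : ℂ) * e ω) + (V ω : ℂ) * e ω := fun ω => by
      rw [hY]; push_cast; ring
    have h0 := hUV 0 Prod.snd measurable_snd
    simp only [pow_zero, one_mul, hVmean, Complex.ofReal_zero, mul_zero] at h0
    simp_rw [hexp]
    rw [integral_add ((hint W hWi).const_mul _) (hint V hVi), integral_const_mul,
      integral_congr_ae (Filter.Eventually.of_forall fun ω => mul_comm (V ω : ℂ) (e ω)), h0,
      add_zero]
  have hXYe : ∫ ω, (X ω : ℂ) * (Y ω : ℂ) * e ω ∂P =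
      α * β * (∫ ω, (W ω : ℂ) ^ 2 * e ω ∂P - ∫ ω, e ω ∂P) := by
    have hexp : ∀ ω, (X ω : ℂ) * (Y ω : ℂ) * e ω = α * β * ((W ω : ℂ) ^ 2 * e ω) +
        α * ((W ω : ℂ) ^ 1 * e ω * (V ω : ℂ)) + β * ((W ω : ℂ) ^ 1 * e ω * (U ω : ℂ)) +
        (W ω : ℂ) ^ 0 * e ω * ((U ω * V ω : ℝ) : ℂ) := fun ω => by
      rw [hX, hY]; push_cast; ring
    have h1 := hUV 1 Prod.fst measurable_fst
    have h2 := hUV 1 Prod.snd measurable_snd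
    have h3 := hUV 0 (fun p => p.1 * p.2) (by fun_prop)
    simp only [hUmean, hVmean, hUVcov, Complex.ofReal_zero, mul_zero] at h1 h2 h3
    have i1 : Integrable (fun ω => α * β * ((W ω : ℂ) ^ 2 * e ω)) P := by
      have := (hint _ hW.integrable_sq).const_mul ((α : ℂ) * β)
      simpa only [Complex.ofReal_pow] using this
    have i2 : Integrable (fun ω => α * ((W ω : ℂ) ^ 1 * e ω * (V ω : ℂ))) P := by
      refine ((hint _ (hW.integrable_mul hV)).const_mul (α : ℂ)).congr
        (Filter.Eventually.of_forall fun ω => ?_)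
      simp only [Pi.mul_apply, Complex.ofReal_mul]; ring
    have i3 : Integrable (fun ω => β * ((W ω : ℂ) ^ 1 * e ω * (U ω : ℂ))) P := by
      refine ((hint _ (hW.integrable_mul hU)).const_mul (β : ℂ)).congr
        (Filter.Eventually.of_forall fun ω => ?_)
      simp only [Pi.mul_apply, Complex.ofReal_mul]; ring
    have i4 : Integrable (fun ω => (W ω : ℂ) ^ 0 * e ω * ((U ω * V ω : ℝ) : ℂ)) P := by
      refine (hint _ (hU.integrable_mul hV)).congr (Filter.Eventually.of_forall fun ω => ?_)
      simp only [Pi.mul_apply, Complex.ofReal_mul]; ring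
    simp_rw [hexp]
    rw [integral_add (by exact (i1.add i2).add i3) i4, integral_add (by exact i1.add i2) i3, integral_add i1 i2,
      integral_const_mul, integral_const_mul, integral_const_mul, h1, h2, h3]
    simp only [pow_zero, one_mul]
    push_cast
    ring
  have f00 := hfactor 0 0
  have f10 := hfactor 1 0
  have f01 := hfactor 0 1
  have f11 := hfactor 1 1
  simp only [pow_zero, pow_one, one_mul, mul_one] at f00 f10 f01 f11
  have hαβ' : (α : ℂ) * β ≠ 0 := by exact_mod_cast hαβ
  refine mul_left_cancel₀ hαβ' ?_
  -- After factorization both middle products consist of the same six integrals.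
  calc (α : ℂ) * β * ((∫ ω, e ω ∂P) * (∫ ω, (W ω : ℂ) ^ 2 * e ω ∂P - ∫ ω, e ω ∂P))
      = (∫ ω, e ω ∂P) * ∫ ω, (X ω : ℂ) * (Y ω : ℂ) * e ω ∂P := by rw [hXYe]; ring
    _ = (∫ ω, (X ω : ℂ) * e ω ∂P) * ∫ ω, (Y ω : ℂ) * e ω ∂P := by
      rw [f00, f11, f10, f01]; ring
    _ = (α : ℂ) * β * (∫ ω, (W ω : ℂ) * e ω ∂P) ^ 2 := by rw [hXe, hYe]; ring

/-! ### Linear mixtures of independent coordinates -/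

/-- A member of an independent family of random variables is independent of every measurable
function of finitely many other members. -/
lemma indepFun_comp_of_notMem {S : Type*} [MeasurableSpace S] {P : Measure S}
    {ι F : Type*} [MeasurableSpace F] {z : S → ι → ℝ}
    (hz : iIndepFun (fun k ω => z ω k) P) (hm : ∀ k, AEMeasurable (fun ω => z ω k) P) (k : ι)
    {s : Finset ι} (hk : k ∉ s) {g : (s → ℝ) → F} (hg : Measurable g) :
    IndepFun (fun ω => z ω k) (fun ω => g fun l => z ω l) P :=
  (hz.indepFun_finset₀ {k} s (Finset.disjoint_singleton_left.2 hk) hm).comp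
    (φ := fun a : ({k} : Finset ι) → ℝ => a ⟨k, Finset.mem_singleton_self k⟩) (ψ := g)
    (by fun_prop) hg

/-- If the coordinates of `z` are independent and standardized and those of `y = A z` are
independent, then a coordinate of `z` entering two coordinates of `y` is Gaussian. -/
lemma hasGaussianLaw_of_mixing {S : Type*} [MeasurableSpace S] {P : Measure S}
    [IsProbabilityMeasure P] {ι : Type*} [Fintype ι] [DecidableEq ι] {z y : S → ι → ℝ}
    {A B : Matrix ι ι ℝ} (hz : iIndepFun (fun k ω => z ω k) P)
    (hz2 : ∀ k, MemLp (fun ω => z ω k) 2 P) (hz0 : ∀ k, ∫ ω, z ω k ∂P = 0)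
    (hz1 : ∀ k, ∫ ω, z ω k ^ 2 ∂P = 1) (hy : iIndepFun (fun k ω => y ω k) P)
    (hyz : ∀ ω, y ω = A.mulVec (z ω)) (hzy : ∀ ω, z ω = B.mulVec (y ω))
    {i j k : ι} (hij : i ≠ j) (hne : A i k * A j k ≠ 0) :
    HasGaussianLaw (fun ω => z ω k) P := by
  have hzm : ∀ k, AEMeasurable (fun ω => z ω k) P := fun k =>
    (hz2 k).aestronglyMeasurable.aemeasurable
  have hym : ∀ i, AEMeasurable (fun ω => y ω i) P := fun i => by
    simp only [hyz, Matrix.mulVec, dotProduct]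
    fun_prop
  have hrest2 : ∀ i, MemLp (fun ω => ∑ l ∈ Finset.univ.erase k, A i l * z ω l) 2 P := fun i =>
    memLp_finsetSum _ fun l _ => (hz2 l).const_mul _
  have hrest0 : ∀ i, ∫ ω, ∑ l ∈ Finset.univ.erase k, A i l * z ω l ∂P = 0 := fun i => by
    rw [integral_finsetSum _ fun l _ => ((hz2 l).integrable (by norm_num)).const_mul _]
    simp [integral_const_mul, hz0]
  have hsplit : ∀ i ω, y ω i = A i k * z ω k + ∑ l ∈ Finset.univ.erase k, A i l * z ω l :=
    fun i ω => by
      rw [hyz, Finset.add_sum_erase _ (fun l => A i l * z ω l) (Finset.mem_univ k)]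
      rfl
  have hji : j ∈ Finset.univ.erase i := by simp [hij.symm]
  -- `U`, `V` are what remains of rows `i`, `j` of `A` without column `k`; `a`, `b`, `R` come from
  -- row `k` of the inverse map `B`.
  refine hasGaussianLaw_of_indepFun_combinations (X := fun ω => y ω i) (Y := fun ω => y ω j)
    (R := fun ω => ∑ m ∈ (Finset.univ.erase i).erase j, B k m * y ω m) (a := B k i) (b := B k j)
    (hz2 k) (hrest2 i) (hrest2 j) (by fun_prop) (hz0 k) (hrest0 i) (hrest0 j) (hz1 k) ?_
    (hsplit i) (hsplit j) ?_ ?_ ?_ hne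
  · have hsum : ∀ i ω, ∑ l : (Finset.univ.erase k : Finset ι), A i l * z ω l =
        ∑ l ∈ Finset.univ.erase k, A i l * z ω l := fun i ω =>
      Finset.sum_coe_sort _ fun l => A i l * z ω l
    have := indepFun_comp_of_notMem hz hzm k (Finset.notMem_erase k Finset.univ)
      (g := fun v => (∑ l : (Finset.univ.erase k : Finset ι), A i l * v l,
        ∑ l : (Finset.univ.erase k : Finset ι), A j l * v l)) (by fun_prop)
    simpa only [hsum] using this
  -- `R` is rewritten over the same index set as `y j`, so that the pair is a function of the
  -- coordinates other than `i`.
  · have hsum : ∀ ω, ∑ m : (Finset.univ.erase i : Finset ι), B k m * y ω m - B k j * y ω j =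
        ∑ m ∈ (Finset.univ.erase i).erase j, B k m * y ω m := fun ω => by
      rw [Finset.sum_coe_sort _ fun m => B k m * y ω m,
        ← Finset.add_sum_erase _ (fun m => B k m * y ω m) hji]
      ring
    have := indepFun_comp_of_notMem hy hym i (Finset.notMem_erase i Finset.univ)
      (g := fun v => (v ⟨j, hji⟩, ∑ m : (Finset.univ.erase i : Finset ι), B k m * v m -
        B k j * v ⟨j, hji⟩)) (by fun_prop)
    simpa only [hsum] using this
  · have hsum : ∀ ω, ∑ m : ((Finset.univ.erase i).erase j : Finset ι), B k m * y ω m =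
        ∑ m ∈ (Finset.univ.erase i).erase j, B k m * y ω m := fun ω =>
      Finset.sum_coe_sort _ fun m => B k m * y ω m
    have := indepFun_comp_of_notMem hy hym j
      (Finset.notMem_erase j (Finset.univ.erase i))
      (g := fun v => ∑ m : ((Finset.univ.erase i).erase j : Finset ι), B k m * v m) (by fun_prop)
    simpa only [hsum] using this
  · intro ω
    rw [hzy, add_assoc, Finset.add_sum_erase _ (fun m => B k m * y ω m) hji,
      Finset.add_sum_erase _ (fun m => B k m * y ω m) (Finset.mem_univ i)]
    rfl

/-! ### Reduction to an orthogonal mixing matrix -/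

/-- A matrix that maps a standardized uncorrelated vector to another one is orthogonal. -/
lemma mul_transpose_eq_one_of_standardized {S : Type*} [MeasurableSpace S] {P : Measure S}
    {ι : Type*} [Fintype ι] [DecidableEq ι] {z y : S → ι → ℝ} {A : Matrix ι ι ℝ}
    (hz : iIndepFun (fun k ω => z ω k) P)
    (hz2 : ∀ k, MemLp (fun ω => z ω k) 2 P) (hz0 : ∀ k, ∫ ω, z ω k ∂P = 0)
    (hz1 : ∀ k, ∫ ω, z ω k ^ 2 ∂P = 1) (hy : iIndepFun (fun k ω => y ω k) P)
    (hy2 : ∀ k, MemLp (fun ω => y ω k) 2 P) (hy0 : ∀ k, ∫ ω, y ω k ∂P = 0)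
    (hy1 : ∀ k, ∫ ω, y ω k ^ 2 ∂P = 1)
    (hyz : ∀ ω, y ω = A.mulVec (z ω)) : A * A.transpose = 1 := by
  have hcov : ∀ {w : S → ι → ℝ}, iIndepFun (fun k ω => w ω k) P →
      (∀ k, MemLp (fun ω => w ω k) 2 P) → (∀ k, ∫ ω, w ω k ∂P = 0) →
      (∀ k, ∫ ω, w ω k ^ 2 ∂P = 1) →
      ∀ i j, ∫ ω, w ω i * w ω j ∂P = (1 : Matrix ι ι ℝ) i j := by
    intro w hw hw2 hw0 hw1 i j
    rcases eq_or_ne i j with rfl | hij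
    · simpa [sq] using hw1 i
    · rw [(hw.indepFun hij).integral_fun_mul_eq_mul_integral (hw2 i).1 (hw2 j).1, hw0,
        zero_mul, Matrix.one_apply_ne hij]
  ext i j
  rw [← hcov hy hy2 hy0 hy1 i j]
  have hexp : ∀ ω, y ω i * y ω j = ∑ k, ∑ l, A i k * A j l * (z ω k * z ω l) := fun ω => by
    simp only [hyz, Matrix.mulVec, dotProduct]
    rw [Finset.sum_mul_sum]
    exact Finset.sum_congr rfl fun k _ => Finset.sum_congr rfl fun l _ => by ring
  have hint : ∀ k l, Integrable (fun ω => A i k * A j l * (z ω k * z ω l)) P := fun k l =>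
    ((hz2 k).integrable_mul (hz2 l)).const_mul _
  simp_rw [hexp]
  rw [integral_finsetSum _ fun k _ => integrable_finsetSum _ fun l _ => hint k l]
  simp_rw [integral_finsetSum _ fun l _ => hint _ l, integral_const_mul, hcov hz hz2 hz0 hz1]
  simp [Matrix.mul_apply, Matrix.one_apply]

/-- The sources of two signal separation models with the same observed law are related, in law,
by the linear map `Ω'⁻¹ Ω`. -/
lemma identDistrib_sources {p d : ℕ} {S : Type*} [MeasurableSpace S] {P : Measure S}
    [IsProbabilityMeasure P] {S' : Type*} [MeasurableSpace S'] {P' : Measure S'}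
    {μ μ' : Fin p → ℝ} {Ω Ω' : Matrix (Fin p) (Fin p) ℝ} {z x : S → Fin p → ℝ}
    {z' x' : S' → Fin p → ℝ} (hx : IsSignalSeparationModel P d μ Ω z x)
    (hx' : IsSignalSeparationModel P' d μ' Ω' z' x') (hlaw : IdentDistrib x x' P P') :
    IdentDistrib (fun ω => (Ω'⁻¹ * Ω).mulVec (z ω)) z' P P' := by
  set A := Ω'⁻¹ * Ω with hA
  set c := Ω'⁻¹.mulVec (μ - μ') with hc
  have hzm : AEMeasurable z P := aemeasurable_pi_iff.2 fun k =>
    (hx.memLp k).aestronglyMeasurable.aemeasurable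
  have hzm' : AEMeasurable z' P' := aemeasurable_pi_iff.2 fun k =>
    (hx'.memLp k).aestronglyMeasurable.aemeasurable
  have hmul : ∀ M : Matrix (Fin p) (Fin p) ℝ, Measurable fun v : Fin p → ℝ => M.mulVec v :=
    fun M => (Continuous.matrix_mulVec continuous_const continuous_id).measurable
  have h1 : IdentDistrib (fun ω => c + A.mulVec (z ω)) (fun ω => Ω'⁻¹.mulVec (x ω - μ')) P P := by
    refine IdentDistrib.of_ae_eq ?_ ?_
    · exact ((hmul A).comp_aemeasurable hzm).const_add c
    · filter_upwards [hx.observed_eq] with ω hω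
      rw [hω, hc, hA, ← Matrix.mulVec_mulVec, ← Matrix.mulVec_add]
      congr 1
      abel
  have h2 : IdentDistrib (fun ω => Ω'⁻¹.mulVec (x ω - μ')) (fun ω => Ω'⁻¹.mulVec (x' ω - μ'))
      P P' := hlaw.comp ((hmul Ω'⁻¹).comp (measurable_id.sub_const μ'))
  have h3 : IdentDistrib z' (fun ω => Ω'⁻¹.mulVec (x' ω - μ')) P' P' := by
    refine IdentDistrib.of_ae_eq hzm' ?_
    filter_upwards [hx'.observed_eq] with ω hω
    rw [hω, add_sub_cancel_left, Matrix.mulVec_mulVec, Matrix.nonsing_inv_mul _ hx'.nonsingular,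
      Matrix.one_mulVec]
  have h := (h1.trans h2).trans h3.symm
  -- Taking expectations: `A z` and `z'` are both centred.
  have hc0 : c = 0 := by
    funext i
    have hi := (h.comp (measurable_pi_apply i)).integral_eq
    simp only [Function.comp_def, Pi.add_apply, hx'.mean_eq_zero, Matrix.mulVec, dotProduct] at hi
    have hterm : ∀ k, Integrable (fun ω => A i k * z ω k) P := fun k =>
      ((hx.memLp k).integrable (by norm_num)).const_mul _
    rw [integral_add (integrable_const _) (integrable_finsetSum _ fun k _ => hterm k),
      integral_finsetSum _ fun k _ => hterm k] at hi
    simpa [integral_const_mul, hx.mean_eq_zero] using hi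
  simpa [hc0] using h

/-- An orthogonal matrix with a column that has at most one nonzero entry has there exactly one,
equal to `1` or `-1`, which is also the only nonzero entry of its row. -/
lemma exists_eq_one_or_neg_one_of_orthogonal {ι : Type*} [Fintype ι] [DecidableEq ι]
    {A : Matrix ι ι ℝ} (hA : A * A.transpose = 1) {k : ι}
    (h : ∀ i j, i ≠ j → A i k * A j k = 0) :
    ∃ i, (A i k = 1 ∨ A i k = -1) ∧ (∀ j, j ≠ i → A j k = 0) ∧ ∀ l, l ≠ k → A i l = 0 := by
  have hcol : ∑ i, A i k ^ 2 = 1 := by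
    have hA' : A.transpose * A = 1 := mul_eq_one_comm.1 hA
    have := congrFun (congrFun hA' k) k
    simpa [Matrix.mul_apply, sq] using this
  obtain ⟨i, hi⟩ : ∃ i, A i k ≠ 0 := by
    by_contra! h0
    simp [h0] at hcol
  have hz : ∀ j, j ≠ i → A j k = 0 := fun j hj =>
    (mul_eq_zero.1 (h j i hj)).resolve_right hi
  have hik : A i k ^ 2 = 1 := by
    rw [← hcol, Finset.sum_eq_single i (fun j _ hj => by simp [hz j hj]) (by simp)]
  refine ⟨i, sq_eq_one_iff.1 hik, hz, ?_⟩
  -- The entry at `k` already exhausts the unit norm of row `i`.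
  have hrow : ∑ l, A i l ^ 2 = 1 := by
    have := congrFun (congrFun hA i) i
    simpa [Matrix.mul_apply, sq] using this
  rw [← Finset.add_sum_erase _ _ (Finset.mem_univ k), hik, add_eq_left,
    Finset.sum_eq_zero_iff_of_nonneg fun _ _ => sq_nonneg _] at hrow
  intro l hl
  exact pow_eq_zero_iff two_ne_zero |>.1 (hrow l (by simp [hl]))

/-! ### Identification of the signal columns -/

theorem corollary1 {p d : ℕ} (hd : d ≤ p)
    {S : Type*} [MeasurableSpace S] (P : Measure S) [IsProbabilityMeasure P]
    {S' : Type*} [MeasurableSpace S'] (P' : Measure S') [IsProbabilityMeasure P']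
    (μ μ' : Fin p → ℝ) (Ω Ω' : Matrix (Fin p) (Fin p) ℝ)
    (z x : S → Fin p → ℝ) (z' x' : S' → Fin p → ℝ)
    (hx : IsSignalSeparationModel P d μ Ω z x)
    (hx' : IsSignalSeparationModel P' d μ' Ω' z' x')
    (hlaw : IdentDistrib x x' P P') :
    ∃ (σ : Equiv.Perm (Fin d)) (ε : Fin d → ℝ),
      (∀ j, ε j = 1 ∨ ε j = -1) ∧
      ∀ i j, signalBlock hd Ω' i j = ε j * signalBlock hd Ω i (σ j) := by
  have hid := identDistrib_sources hx hx' hlaw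
  set A := Ω'⁻¹ * Ω with hAdef
  set y : S → Fin p → ℝ := fun ω => A.mulVec (z ω) with hydef
  have hidk : ∀ k, IdentDistrib (fun ω => y ω k) (fun ω => z' ω k) P P' := fun k =>
    hid.comp (measurable_pi_apply k)
  -- Independence depends only on the joint law, so it passes from `z'` to `y`.
  have hy : iIndepFun (fun k ω => y ω k) P := by
    have h' := hx'.indep.map_fun_eq_pi_map fun k => (hidk k).aemeasurable_snd
    rw [iIndepFun_iff_map_fun_eq_pi_map fun k => (hidk k).aemeasurable_fst]
    simp_rw [(hidk _).map_eq]
    exact hid.map_eq.trans h'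
  have hy2 : ∀ k, MemLp (fun ω => y ω k) 2 P := fun k => (hidk k).memLp_iff.2 (hx'.memLp k)
  have hy0 : ∀ k, ∫ ω, y ω k ∂P = 0 := fun k =>
    (hidk k).integral_eq.trans (hx'.mean_eq_zero k)
  have hy1 : ∀ k, ∫ ω, y ω k ^ 2 ∂P = 1 := fun k =>
    ((hidk k).comp (measurable_id.pow_const 2)).integral_eq.trans (hx'.second_moment_eq_one k)
  have horth := mul_transpose_eq_one_of_standardized hx.indep hx.memLp hx.mean_eq_zero
    hx.second_moment_eq_one hy hy2 hy0 hy1 fun _ => rfl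
  have hzy : ∀ ω, z ω = A.transpose.mulVec (y ω) := fun ω => by
    rw [hydef, Matrix.mulVec_mulVec, mul_eq_one_comm.1 horth, Matrix.one_mulVec]
  have hmix : ∀ k : Fin d, ∀ i j, i ≠ j → A i (k.castLE hd) * A j (k.castLE hd) = 0 := by
    intro k i j hij
    by_contra hne
    exact hx.signal_nonGaussian (k.castLE hd) k.isLt <| hasGaussianLaw_of_mixing hx.indep hx.memLp
      hx.mean_eq_zero hx.second_moment_eq_one hy (fun _ => rfl) hzy hij hne
  choose τ hsign hcol hrow using fun k => exists_eq_one_or_neg_one_of_orthogonal horth (hmix k)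
  have hτ : ∀ k, (τ k).val < d := by
    intro k
    -- Otherwise `z k`, a sign times a coordinate of `y` distributed as Gaussian noise, would be
    -- Gaussian.
    by_contra! hk
    have hg : HasGaussianLaw (fun ω => y ω (τ k)) P :=
      ⟨(hidk (τ k)).map_eq ▸ (hx'.noise_gaussian _ hk).isGaussian_map⟩
    have hyk : ∀ ω, A (τ k) (k.castLE hd) • y ω (τ k) = z ω (k.castLE hd) := fun ω => by
      have : y ω (τ k) = A (τ k) (k.castLE hd) * z ω (k.castLE hd) := by
        simp only [hydef, Matrix.mulVec, dotProduct]
        exact Finset.sum_eq_single _ (fun l _ hl => by rw [hrow k l hl, zero_mul]) (by simp)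
      rw [this]
      rcases hsign k with h | h <;> simp [h]
    have := hg.fun_smul (A (τ k) (k.castLE hd))
    simp_rw [hyk] at this
    exact hx.signal_nonGaussian (k.castLE hd) k.isLt this
  let ρ : Fin d → Fin d := fun k => ⟨τ k, hτ k⟩
  have hρτ : ∀ k, (ρ k).castLE hd = τ k := fun k => rfl
  have hρ : Function.Injective ρ := by
    intro k l hkl
    by_contra hne
    have hτkl : τ k = τ l := by rw [← hρτ, ← hρτ, hkl]
    -- Two signal columns sharing a row would contradict the uniqueness of its nonzero entry.
    have h0 := hrow k (l.castLE hd) fun h => hne (Fin.castLE_injective hd h).symm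
    rw [hτkl] at h0
    rcases hsign l with h | h <;> simp [h0] at h
  have hΩ : Ω' * A = Ω := by
    rw [hAdef, Matrix.mul_nonsing_inv_cancel_left _ _ hx'.nonsingular]
  let e : Equiv.Perm (Fin d) := Equiv.ofBijective ρ (Finite.injective_iff_bijective.1 hρ)
  -- `e` sends a column of `Ω` to one of `Ω'`, hence the inverse; the sign can change sides because
  -- it is its own inverse.
  refine ⟨e.symm, fun j => A (τ (e.symm j)) ((e.symm j).castLE hd), fun j => hsign _, ?_⟩
  intro i j
  obtain ⟨k, rfl⟩ := e.surjective j
  have hek : (e k).castLE hd = τ k := rfl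
  have hΩk : Ω i (k.castLE hd) = Ω' i (τ k) * A (τ k) (k.castLE hd) := by
    rw [← hΩ, Matrix.mul_apply]
    exact Finset.sum_eq_single _ (fun l _ hl => by rw [hcol k l hl, mul_zero]) (by simp)
  simp only [signalBlock, Matrix.submatrix_apply, id, e.symm_apply_apply, hek, hΩk]
  rcases hsign k with h | h <;> simp [h]
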